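/- A cooperative inverse reinforcement learning (CIRL) game is a tuple $M=\langle \mathcal S,\{\mathcal A^{H},\mathcal A^{R}\},T,\{\Theta,R\},P_0,\gamma\rangle$, where $\mathcal S$ is a countable set of world states, $\mathcal A^H$ and $\mathcal A^R$ are finite nonempty action sets of the human and of the robot, $T(\cdot\mid s,a^H,a^R)$ is a probability distribution on $\mathcal S$, $\Theta$ is an arbitrary measurable space of reward parameters, $R(s,a^H,a^R;\theta)\in\mathbb R$ is a reward function, measurable in $\theta$, $P_0$ is a probability distribution on $\mathcal S\times\Theta$, and $\gamma\in[0,1]$. First $(s_0,\theta)\sim P_0$ is drawn; only the human observes $\theta$. At each time $t$ both players observe the history $h_t=(s_0,a^H_0,a^R_0,s_1,\dots,a^H_{t-1},a^R_{t-1},s_t)$ and choose $a^H_t=\pi^H(h_t,\theta)$ and $a^R_t=\pi^R(h_t)$; both receive $r_t=R(s_t,a^H_t,a^R_t;\theta)$, and $s_{t+1}\sim T(\cdot\mid s_t,a^H_t,a^R_t)$. Here $\pi^H$ (measurable in $\theta$) and $\pi^R$ are arbitrary functions of the history. A policy pair is optimal if it maximizes the value $\sum_{t\ge 0}\gamma^t\,\mathbb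 E[r_t]$ among all policy pairs. Assume that values are well defined, uniformly in the policies: $\mathbb E|r_t|<\infty$ for every policy pair and every $t$, and $\sup_{(\pi^H,\pi^R)}\sum_{t\ge N}\gamma^t\,\mathbb E|r_t|\to 0$ as $N\to\infty$. (This is automatic if $\gamma<1$ and $R$ is bounded; for $\gamma=1$ and bounded $R$ it covers games in which no reward is received from some fixed time on.) Then there is an optimal policy pair $(\pi^{H*},\pi^{R*})$ that depends on the history only through the current world state and the robot's belief: there are functions $f$ and $g$ such that for every history $h$ with current state $s$, $$\pi^{R*}(h)=g(s,b_h),\qquad \pi^{H*}(h,\theta)=f(s,b_h,\theta)\quad\text{for all }\theta\in\Theta,$$ where $b_h$ is the posterior distribution of $\theta$ given that the history $h$ has been observed under $(\pi^{H*},\pi^{R*})$ (with $b_h:=0$ if $h$ has probability zero). -/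

import Mathlib

open MeasureTheory Filter Topology
open scoped ENNReal

/-- A cooperative inverse reinforcement learning game with world states `S`, human actions `AH`,
robot actions `AR` and static reward parameters `Θ`. -/
structure CIRLGame (S AH AR Θ : Type*) [MeasurableSpace S] [MeasurableSpace Θ] where
  /-- Conditional distribution of the next world state given the state and the joint action. -/
  T : S → AH → AR → PMF S
  /-- Parameterized reward, common to both players. -/
  R : S → AH → AR → Θ → ℝ
  measurable_R : ∀ s aH aR, Measurable (R s aH aR)
  /-- Joint distribution of the initial world state and the reward parameter. -/
  P₀ : Measure (S × Θ)
  isProbabilityMeasure_P₀ : IsProbabilityMeasure P₀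
  /-- Discount factor. -/
  γ : ℝ
  γ_nonneg : 0 ≤ γ
  γ_le_one : γ ≤ 1

/-- Common observation histories `s₀, (aᴴ₀, aᴿ₀, s₁), (aᴴ₁, aᴿ₁, s₂), …, sₜ`. -/
inductive CIRLHistory (S AH AR : Type*) where
  | start (s : S) : CIRLHistory S AH AR
  | step (h : CIRLHistory S AH AR) (aH : AH) (aR : AR) (s : S) : CIRLHistory S AH AR

namespace CIRLHistory

variable {S AH AR : Type*}

/-- The current world state, i.e. the last one of the history. -/
def current : CIRLHistory S AH AR → S
  | start s => s
  | step _ _ _ s => s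

/-- The current time, i.e. the number of joint actions already taken. -/
def time : CIRLHistory S AH AR → ℕ
  | start _ => 0
  | step h _ _ _ => h.time + 1

end CIRLHistory

/-- A pair of policies. Both players observe the history; only the human observes `θ`. -/
structure CIRLPolicyPair (S AH AR Θ : Type*) [MeasurableSpace Θ] where
  /-- The policy of the human. -/
  human : CIRLHistory S AH AR → Θ → AH
  /-- The policy of the robot. -/
  robot : CIRLHistory S AH AR → AR
  measurableSet_human : ∀ h aH, MeasurableSet {θ | human h θ = aH}

namespace CIRLGame

variable {S AH AR Θ : Type*} [MeasurableSpace S] [MeasurableSpace Θ]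

/-- The law of the history at time `t` when the policy pair `π` is played from the initial
world state `s` with reward parameter `θ`. -/
noncomputable def historyLaw (M : CIRLGame S AH AR Θ) (π : CIRLPolicyPair S AH AR Θ)
    (s : S) (θ : Θ) : ℕ → PMF (CIRLHistory S AH AR)
  | 0 => PMF.pure (.start s)
  | t + 1 => (M.historyLaw π s θ t).bind fun h =>
      (M.T h.current (π.human h θ) (π.robot h)).map (h.step (π.human h θ) (π.robot h))

/-- The reward collected right after the history `h`. -/
def reward (M : CIRLGame S AH AR Θ) (π : CIRLPolicyPair S AH AR Θ)
    (h : CIRLHistory S AH AR) (θ : Θ) : ℝ :=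
  M.R h.current (π.human h θ) (π.robot h) θ

/-- The expected reward `E[rₜ]` at time `t`. -/
noncomputable def expReward (M : CIRLGame S AH AR Θ) (π : CIRLPolicyPair S AH AR Θ)
    (t : ℕ) : ℝ :=
  ∫ x, ∑' h, (M.historyLaw π x.1 x.2 t h).toReal * M.reward π h x.2 ∂M.P₀

/-- The expected absolute reward `E|rₜ|` at time `t`. -/
noncomputable def expAbsReward (M : CIRLGame S AH AR Θ) (π : CIRLPolicyPair S AH AR Θ)
    (t : ℕ) : ℝ≥0∞ :=
  ∫⁻ x, ∑' h, M.historyLaw π x.1 x.2 t h * ‖M.reward π h x.2‖ₑ ∂M.P₀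

/-- The value of a policy pair: the expected sum of discounted rewards. -/
noncomputable def value (M : CIRLGame S AH AR Θ) (π : CIRLPolicyPair S AH AR Θ) : ℝ :=
  ∑' t, M.γ ^ t * M.expReward π t

/-- The value is well defined, uniformly in the policies: expected rewards exist, and the tails
of the discounted sum `∑ γᵗ E|rₜ|` vanish uniformly over all policy pairs. This is automatic
if `γ < 1` and `R` is bounded. For `γ = 1` and bounded `R` it covers games with finite horizon,
in which no reward is received from some time on. -/
structure UniformlyConvergent (M : CIRLGame S AH AR Θ) : Prop where
  expAbsReward_lt_top : ∀ π t, M.expAbsReward π t < ∞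
  tendsto_tail : Tendsto
    (fun N : ℕ => ⨆ π, ∑' t : ℕ, ENNReal.ofReal (M.γ ^ (N + t)) * M.expAbsReward π (N + t))
    atTop (𝓝 0)

/-- An optimal policy pair maximizes the value among all (history-dependent) policy pairs. -/
def IsOptimal (M : CIRLGame S AH AR Θ) (π : CIRLPolicyPair S AH AR Θ) : Prop :=
  ∀ π', M.value π' ≤ M.value π

/-- The subdistribution `B ↦ P(hₜ = h, θ ∈ B)` on reward parameters, where `t` is the time
of `h`. -/
noncomputable def jointWith (M : CIRLGame S AH AR Θ) (π : CIRLPolicyPair S AH AR Θ)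
    (h : CIRLHistory S AH AR) : Measure Θ :=
  (M.P₀.withDensity fun x => M.historyLaw π x.1 x.2 h.time h).map Prod.snd

/-- The belief of the robot: the posterior distribution of `θ` given that the history `h` has
been observed. It is the zero measure if `h` has probability zero under `π`. -/
noncomputable def belief (M : CIRLGame S AH AR Θ) (π : CIRLPolicyPair S AH AR Θ)
    (h : CIRLHistory S AH AR) : Measure Θ :=
  (M.jointWith π h Set.univ)⁻¹ • M.jointWith π h

/-- The policy pair `π` depends on the history only through the current world state and the
belief of the robot: one stationary rule for the robot, and one for the human, who also
observes `θ`. -/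
def DependsOnlyOnStateAndBelief (M : CIRLGame S AH AR Θ) (π : CIRLPolicyPair S AH AR Θ) : Prop :=
  ∃ (ruleH : S → Measure Θ → Θ → AH) (ruleR : S → Measure Θ → AR),
    ∀ h, (∀ θ, π.human h θ = ruleH h.current (M.belief π h) θ) ∧
      π.robot h = ruleR h.current (M.belief π h)

end CIRLGame

/-! Continuity. The value is an absolutely convergent sum over the countably many histories. The
term of `h` involves only the decisions at initial segments of `h`, and up to `ε` the sum is carried
by finitely many histories, the same for all policy pairs. Hence the value is uniformly continuous
in the policies for pointwise convergence on histories (`exists_finset_abs_value_sub_le`).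

Existence. Robot policies form a compact product of finite sets. Human policies depend measurably on
an arbitrary `Θ`, so compactness is not at hand; but the human knows `θ` and can select a policy
separately for each initial state and `θ`. This turns a maximizing sequence into one whose
conditional values increase pointwise, and a measurable cluster point of it is a best response
(`exists_best_response`). The best-response value is continuous in the robot's policy, so it attains
its maximum (`exists_isOptimal`).

Stationarity. After a history `p` of positive probability the game continues, up to a constant
factor, as the game started at the current state with the belief as prior, and this game inherits
uniform convergence. Fix one optimal pair `σ s b` for each such game and always play its first move.
By induction on `N`, some optimal pair agrees with this stationary pair before time `N`: switching
from time `N` on to the `σ` of the current state and belief loses nothing (`value_le_value_switch`),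
and beliefs at time `N` depend only on earlier decisions, so the move at time `N` is the stationary
one. Continuity then makes the stationary pair itself optimal. No Bellman equation or measurability
in the belief is needed. -/

namespace CIRLHistory

/-! ### Histories and their initial segments -/

variable {S AH AR : Type*}

/-- The initial world state of a history. -/
def init : CIRLHistory S AH AR → S
  | start s => s
  | step h _ _ _ => h.init

/-- The set of initial segments of a history, including the history itself. -/
def prefixes : CIRLHistory S AH AR → Set (CIRLHistory S AH AR)
  | start s => {start s}
  | step h aH aR s => insert (step h aH aR s) h.prefixes

lemma self_mem_prefixes (h : CIRLHistory S AH AR) : h ∈ h.prefixes := by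
  cases h <;> simp [prefixes]

lemma finite_prefixes (h : CIRLHistory S AH AR) : h.prefixes.Finite := by
  induction h with
  | start s => simp [prefixes]
  | step h aH aR s ih => exact ih.insert _

lemma init_of_mem_prefixes {h p : CIRLHistory S AH AR} (hp : p ∈ h.prefixes) :
    p.init = h.init := by
  induction h with
  | start s => rw [prefixes, Set.mem_singleton_iff] at hp; rw [hp]
  | step h aH aR s ih =>
    rcases hp with rfl | hp
    · rfl
    · exact ih hp

lemma time_le_of_mem_prefixes {h p : CIRLHistory S AH AR} (hp : p ∈ h.prefixes) :
    p.time ≤ h.time := by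
  induction h with
  | start s => rw [prefixes, Set.mem_singleton_iff] at hp; rw [hp]
  | step h aH aR s ih =>
    rcases hp with rfl | hp
    · rfl
    · exact (ih hp).trans (Nat.le_succ _)

/-- The initial state and the list of later steps. -/
def toPair : CIRLHistory S AH AR → S × List (AH × AR × S)
  | start s => (s, [])
  | step h aH aR s => (h.toPair.1, (aH, aR, s) :: h.toPair.2)

lemma toPair_injective : Function.Injective (toPair : CIRLHistory S AH AR → _) := by
  intro h
  induction h with
  | start s => intro h' e; cases h' <;> simp_all [toPair]
  | step h aH aR s ih =>
    intro h' e
    cases h' with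
    | start s => simp [toPair] at e
    | step h' aH' aR' s' =>
      simp only [toPair, Prod.mk.injEq, List.cons.injEq] at e
      obtain ⟨e1, ⟨rfl, rfl, rfl⟩, e2⟩ := e
      rw [ih (Prod.ext e1 e2)]

instance [Countable S] [Finite AH] [Finite AR] : Countable (CIRLHistory S AH AR) :=
  toPair_injective.countable

end CIRLHistory

namespace CIRLGame

open CIRLHistory

/-! ### Likelihood of a history -/

section Likelihood

variable {S AH AR Θ : Type*} [MeasurableSpace S] [MeasurableSpace Θ]
  (M : CIRLGame S AH AR Θ) (π : CIRLPolicyPair S AH AR Θ)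

/-- The probability that the history `h` is observed, given the initial state and the reward
parameter. -/
noncomputable def likelihood (x : S × Θ) (h : CIRLHistory S AH AR) : ℝ≥0∞ :=
  M.historyLaw π x.1 x.2 h.time h

open Classical in
lemma historyLaw_succ_step (s : S) (θ : Θ) (t : ℕ) (h : CIRLHistory S AH AR) (aH : AH) (aR : AR)
    (s' : S) :
    M.historyLaw π s θ (t + 1) (step h aH aR s') = M.historyLaw π s θ t h *
      (if π.human h θ = aH ∧ π.robot h = aR then M.T h.current aH aR s' else 0) := by
  rw [historyLaw, PMF.bind_apply, tsum_eq_single h]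
  · congr 1
    rw [PMF.map_apply]
    split_ifs with hc
    · obtain ⟨rfl, rfl⟩ := hc
      rw [tsum_eq_single s']
      · simp
      · intro s'' hs
        simp [hs.symm]
    · rw [ENNReal.tsum_eq_zero]
      intro s''
      rw [if_neg]
      intro e
      injection e with _ e1 e2
      exact hc ⟨e1.symm, e2.symm⟩
  · intro h' hh
    rw [PMF.map_apply, mul_eq_zero]
    right
    rw [ENNReal.tsum_eq_zero]
    intro s''
    rw [if_neg]
    intro e
    injection e with e1
    exact hh e1.symm

lemma historyLaw_succ_start (s : S) (θ : Θ) (t : ℕ) (s' : S) :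
    M.historyLaw π s θ (t + 1) (start s') = 0 := by
  rw [historyLaw, PMF.bind_apply, ENNReal.tsum_eq_zero]
  intro h
  rw [PMF.map_apply, mul_eq_zero]
  right
  rw [ENNReal.tsum_eq_zero]
  intro s''
  simp

/-- A history determines its time. This is what merges the double sum over times and histories into
one sum over histories. -/
lemma historyLaw_eq_zero (s : S) (θ : Θ) {t : ℕ} {h : CIRLHistory S AH AR} (ht : h.time ≠ t) :
    M.historyLaw π s θ t h = 0 := by
  induction h generalizing t with
  | start s' =>
    cases t with
    | zero => exact absurd rfl ht
    | succ t => exact M.historyLaw_succ_start π s θ t s'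
  | step h aH aR s' ih =>
    cases t with
    | zero => simp [historyLaw]
    | succ t =>
      rw [historyLaw_succ_step, ih (by simpa [time] using ht), zero_mul]

open Classical in
lemma likelihood_start (x : S × Θ) (s : S) :
    M.likelihood π x (start s) = if s = x.1 then 1 else 0 := by
  simp [likelihood, time, historyLaw, PMF.pure_apply]

open Classical in
lemma likelihood_step (x : S × Θ) (h : CIRLHistory S AH AR) (aH : AH) (aR : AR) (s : S) :
    M.likelihood π x (step h aH aR s) = M.likelihood π x h *
      (if π.human h x.2 = aH ∧ π.robot h = aR then M.T h.current aH aR s else 0) :=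
  M.historyLaw_succ_step π _ _ _ _ _ _ _

lemma likelihood_eq_zero {x : S × Θ} {h : CIRLHistory S AH AR} (hx : h.init ≠ x.1) :
    M.likelihood π x h = 0 := by
  induction h with
  | start s => rw [likelihood_start, if_neg (show s ≠ x.1 from hx)]
  | step h aH aR s ih => rw [likelihood_step, ih hx, zero_mul]

lemma likelihood_le_one (x : S × Θ) (h : CIRLHistory S AH AR) : M.likelihood π x h ≤ 1 :=
  PMF.coe_le_one _ _

lemma likelihood_ne_top (x : S × Θ) (h : CIRLHistory S AH AR) : M.likelihood π x h ≠ ∞ :=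
  PMF.apply_ne_top _ _

variable {M π} in
/-- Along `h`, at the reward parameter `θ`, only the decisions at initial segments of `h`
matter. -/
lemma likelihood_congr {π' : CIRLPolicyPair S AH AR Θ} {x : S × Θ} {h : CIRLHistory S AH AR}
    (hp : ∀ p ∈ h.prefixes, p.time < h.time →
      π.human p x.2 = π'.human p x.2 ∧ π.robot p = π'.robot p) :
    M.likelihood π x h = M.likelihood π' x h := by
  induction h with
  | start s => simp only [likelihood_start]
  | step h aH aR s ih =>
    obtain ⟨e1, e2⟩ := hp h (Set.mem_insert_of_mem _ h.self_mem_prefixes) (Nat.lt_succ_self _)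
    rw [likelihood_step, likelihood_step, e1, e2, ih fun p hph ht =>
      hp p (Set.mem_insert_of_mem _ hph) (ht.trans (Nat.lt_succ_self _))]

variable {M π} in
lemma reward_congr {π' : CIRLPolicyPair S AH AR Θ} {θ : Θ} {h : CIRLHistory S AH AR}
    (h1 : π.human h θ = π'.human h θ) (h2 : π.robot h = π'.robot h) :
    M.reward π h θ = M.reward π' h θ := by
  rw [reward, reward, h1, h2]

lemma measurable_reward [Finite AH] (h : CIRLHistory S AH AR) :
    Measurable fun θ : Θ => M.reward π h θ := by
  let _ : MeasurableSpace AH := ⊤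
  have hm : Measurable fun θ => (π.human h θ, θ) :=
    (measurable_to_countable' fun a => π.measurableSet_human h a).prodMk measurable_id
  have : Measurable fun y : AH × Θ => M.R h.current y.1 (π.robot h) y.2 :=
    measurable_from_prod_countable_right fun a => M.measurable_R _ _ _
  exact this.comp hm

end Likelihood

section Measurability

variable {S AH AR Θ : Type*} [MeasurableSpace S] [MeasurableSingletonClass S] [MeasurableSpace Θ]
  (M : CIRLGame S AH AR Θ) (π : CIRLPolicyPair S AH AR Θ)

lemma measurable_likelihood (h : CIRLHistory S AH AR) :
    Measurable fun x : S × Θ => M.likelihood π x h := by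
  classical
  induction h with
  | start s =>
    simp only [likelihood_start]
    refine Measurable.ite ?_ measurable_const measurable_const
    exact (measurableSet_singleton s).preimage measurable_fst |>.congr (by ext; simp [eq_comm])
  | step h aH aR s ih =>
    simp only [likelihood_step]
    refine ih.mul (Measurable.ite ?_ measurable_const measurable_const)
    by_cases hr : π.robot h = aR
    · simpa [hr] using (π.measurableSet_human h aH).preimage measurable_snd
    · simp [hr]

end Measurability

end CIRLGame

/-! ### The value as a sum over histories -/

lemma ENNReal.tsum_add_eq_tsum_ite (v : ℕ → ℝ≥0∞) (n : ℕ) :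
    ∑' t, v (n + t) = ∑' t, if n ≤ t then v t else 0 := by
  have hinj : Function.Injective fun t : ℕ => n + t := add_right_injective n
  have h2 := hinj.tsum_eq (f := fun t => if n ≤ t then v t else 0)
    fun t ht => by
      by_contra hn
      exact ht (if_neg fun hle => hn ⟨t - n, Nat.add_sub_cancel' hle⟩)
  rw [← h2]
  simp

namespace CIRLGame

open CIRLHistory

variable {S AH AR Θ : Type*} [MeasurableSpace S] [MeasurableSpace Θ]
  (M : CIRLGame S AH AR Θ) (π : CIRLPolicyPair S AH AR Θ)

/-- The contribution of the history `h` to the expected reward. -/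
noncomputable def histReward (h : CIRLHistory S AH AR) : ℝ :=
  ∫ x, (M.likelihood π x h).toReal * M.reward π h x.2 ∂M.P₀

/-- The contribution of the history `h` to the expected absolute reward. -/
noncomputable def histAbsReward (h : CIRLHistory S AH AR) : ℝ≥0∞ :=
  ∫⁻ x, M.likelihood π x h * ‖M.reward π h x.2‖ₑ ∂M.P₀

lemma enorm_likelihood_mul (x : S × Θ) (h : CIRLHistory S AH AR) (r : ℝ) :
    ‖(M.likelihood π x h).toReal * r‖ₑ = M.likelihood π x h * ‖r‖ₑ := by
  rw [enorm_mul, Real.enorm_eq_ofReal ENNReal.toReal_nonneg,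
    ENNReal.ofReal_toReal (M.likelihood_ne_top π x h)]

lemma enorm_histReward_le (h : CIRLHistory S AH AR) :
    ‖M.histReward π h‖ₑ ≤ M.histAbsReward π h := by
  refine (enorm_integral_le_lintegral_enorm _).trans_eq ?_
  simp only [enorm_likelihood_mul, histAbsReward]

lemma ofReal_gamma_pow_ne_top (t : ℕ) : ENNReal.ofReal (M.γ ^ t) ≠ ∞ := ENNReal.ofReal_ne_top

lemma gamma_pow_nonneg (t : ℕ) : 0 ≤ M.γ ^ t := pow_nonneg M.γ_nonneg t

lemma enorm_gamma_pow_mul (t : ℕ) (r : ℝ) :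
    ‖M.γ ^ t * r‖ₑ = ENNReal.ofReal (M.γ ^ t) * ‖r‖ₑ := by
  rw [enorm_mul, Real.enorm_eq_ofReal (M.gamma_pow_nonneg t)]

section Congr

variable {M π} {π' : CIRLPolicyPair S AH AR Θ} {h : CIRLHistory S AH AR}

lemma histReward_congr
    (hp : ∀ p ∈ h.prefixes, π.human p = π'.human p ∧ π.robot p = π'.robot p) :
    M.histReward π h = M.histReward π' h := by
  refine integral_congr_ae (Eventually.of_forall fun x => ?_)
  have e := hp h h.self_mem_prefixes
  simp only
  rw [reward_congr (congrFun e.1 x.2) e.2,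
    likelihood_congr fun p hph _ => ⟨congrFun (hp p hph).1 x.2, (hp p hph).2⟩]

lemma histAbsReward_congr
    (hp : ∀ p ∈ h.prefixes, π.human p = π'.human p ∧ π.robot p = π'.robot p) :
    M.histAbsReward π h = M.histAbsReward π' h := by
  refine lintegral_congr fun x => ?_
  have e := hp h h.self_mem_prefixes
  rw [reward_congr (congrFun e.1 x.2) e.2,
    likelihood_congr fun p hph _ => ⟨congrFun (hp p hph).1 x.2, (hp p hph).2⟩]

end Congr

section Sums

variable [MeasurableSingletonClass S] [Finite AH]

lemma measurable_likelihood_mul_enorm (h : CIRLHistory S AH AR) :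
    Measurable fun x : S × Θ => M.likelihood π x h * ‖M.reward π h x.2‖ₑ :=
  (M.measurable_likelihood π h).mul ((M.measurable_reward π h).comp measurable_snd).enorm

lemma measurable_likelihood_mul_reward (h : CIRLHistory S AH AR) :
    Measurable fun x : S × Θ => (M.likelihood π x h).toReal * M.reward π h x.2 :=
  (M.measurable_likelihood π h).ennreal_toReal.mul
    ((M.measurable_reward π h).comp measurable_snd)

variable [Countable S] [Finite AR]

lemma expAbsReward_eq_tsum (t : ℕ) :
    M.expAbsReward π t = ∑' h : (time ⁻¹' {t} : Set (CIRLHistory S AH AR)),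
      M.histAbsReward π h := by
  have hswap := lintegral_tsum (μ := M.P₀) fun h : (time ⁻¹' {t} : Set (CIRLHistory S AH AR)) =>
    (M.measurable_likelihood_mul_enorm π h.1).aemeasurable
  refine Eq.trans (lintegral_congr fun x => ?_) hswap
  rw [← tsum_subtype_eq_of_support_subset (s := time ⁻¹' {t})]
  · refine tsum_congr fun h => ?_
    rw [likelihood, show h.1.time = t from h.2]
  · intro h hh
    by_contra ht
    exact hh (by simp only [M.historyLaw_eq_zero π x.1 x.2 ht, zero_mul])

/-- Finiteness of `E|rₜ|` is what permits exchanging the sum with the integral for signed rewards.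
-/
lemma expReward_eq_tsum {t : ℕ} (ht : M.expAbsReward π t ≠ ∞) :
    M.expReward π t = ∑' h : (time ⁻¹' {t} : Set (CIRLHistory S AH AR)),
      M.histReward π h := by
  have hfin : ∑' h : (time ⁻¹' {t} : Set (CIRLHistory S AH AR)),
      ∫⁻ x, ‖(M.likelihood π x h.1).toReal * M.reward π h.1 x.2‖ₑ ∂M.P₀ ≠ ∞ := by
    rw [expAbsReward_eq_tsum] at ht
    simpa only [enorm_likelihood_mul, histAbsReward] using ht
  have hswap := integral_tsum (μ := M.P₀)
    (fun h : (time ⁻¹' {t} : Set (CIRLHistory S AH AR)) =>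
      (M.measurable_likelihood_mul_reward π h.1).aestronglyMeasurable) hfin
  refine Eq.trans (integral_congr_ae (Eventually.of_forall fun x => ?_)) hswap
  simp only
  rw [← tsum_subtype_eq_of_support_subset (s := time ⁻¹' {t})]
  · refine tsum_congr fun h => ?_
    rw [likelihood, show h.1.time = t from h.2]
  · intro h hh
    by_contra ht
    exact hh (by simp only [M.historyLaw_eq_zero π x.1 x.2 ht, zero_mul, ENNReal.toReal_zero])

lemma tsum_mul_expAbsReward (w : ℕ → ℝ≥0∞) :
    ∑' t, w t * M.expAbsReward π t =
      ∑' h : CIRLHistory S AH AR, w h.time * M.histAbsReward π h := by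
  rw [← ENNReal.tsum_fiberwise _ (time : CIRLHistory S AH AR → ℕ)]
  refine tsum_congr fun t => ?_
  rw [expAbsReward_eq_tsum, ← ENNReal.tsum_mul_left]
  refine tsum_congr fun h => ?_
  rw [show h.1.time = t from h.2]

open Classical in
lemma tsum_tail_eq (w : ℕ → ℝ≥0∞) (N : ℕ) :
    ∑' t, w (N + t) * M.expAbsReward π (N + t) =
      ∑' h : CIRLHistory S AH AR, if N ≤ h.time then w h.time * M.histAbsReward π h else 0 := by
  have h1 := M.tsum_mul_expAbsReward π fun t => if N ≤ t then w t else 0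
  simp only [ite_mul, zero_mul] at h1
  rw [← h1, ENNReal.tsum_add_eq_tsum_ite fun t => w t * M.expAbsReward π t]

/-- The value is the sum over all histories of the discounted expected rewards. -/
lemma value_eq_tsum
    (hs : ∑' h : CIRLHistory S AH AR,
      ENNReal.ofReal (M.γ ^ h.time) * M.histAbsReward π h ≠ ∞)
    (ht : ∀ t, M.expAbsReward π t ≠ ∞) :
    M.value π = ∑' h : CIRLHistory S AH AR, M.γ ^ h.time * M.histReward π h := by
  have hsum : Summable fun h : CIRLHistory S AH AR => M.γ ^ h.time * M.histReward π h := by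
    refine Summable.of_enorm (ne_top_of_le_ne_top hs (ENNReal.tsum_le_tsum fun h => ?_))
    rw [enorm_gamma_pow_mul]
    gcongr
    exact M.enorm_histReward_le π h
  rw [← (hsum.hasSum.tsum_fiberwise time).tsum_eq, value]
  refine tsum_congr fun t => ?_
  rw [M.expReward_eq_tsum π (ht t), ← tsum_mul_left]
  refine tsum_congr fun h => ?_
  rw [show h.1.time = t from h.2]

end Sums

namespace UniformlyConvergent

variable {M}
variable [MeasurableSingletonClass S] [Countable S] [Finite AH] [Finite AR]

/-- Some tail is below 1, and the finitely many remaining terms are finite by assumption. -/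
lemma tsum_ne_top (hM : M.UniformlyConvergent) :
    ∑' h : CIRLHistory S AH AR, ENNReal.ofReal (M.γ ^ h.time) * M.histAbsReward π h ≠ ∞ := by
  rw [← M.tsum_mul_expAbsReward π fun t => ENNReal.ofReal (M.γ ^ t)]
  obtain ⟨N, hN⟩ := (hM.tendsto_tail.eventually_lt_const (zero_lt_one' ℝ≥0∞)).exists
  have h1 := (le_iSup (fun π => ∑' t : ℕ,
      ENNReal.ofReal (M.γ ^ (N + t)) * M.expAbsReward π (N + t)) π).trans_lt hN
  simp only [add_comm N] at h1
  set f : ℕ → ℝ≥0∞ := fun t => ENNReal.ofReal (M.γ ^ t) * M.expAbsReward π t with hf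
  have h2 : ∑ t ∈ Finset.range N, f t + ∑' t, f (t + N) = ∑' t, f t :=
    ENNReal.summable.sum_add_tsum_nat_add' 
  rw [← h2]
  refine ENNReal.add_ne_top.2 ⟨?_, (h1.trans ENNReal.one_lt_top).ne⟩
  exact ENNReal.sum_ne_top.2 fun t _ =>
    ENNReal.mul_ne_top (M.ofReal_gamma_pow_ne_top t) (hM.expAbsReward_lt_top π t).ne

lemma value_eq (hM : M.UniformlyConvergent) :
    M.value π = ∑' h : CIRLHistory S AH AR, M.γ ^ h.time * M.histReward π h :=
  M.value_eq_tsum π (hM.tsum_ne_top π) fun t => (hM.expAbsReward_lt_top π t).ne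

lemma summable_enorm (hM : M.UniformlyConvergent) :
    ∑' h : CIRLHistory S AH AR, ‖M.γ ^ h.time * M.histReward π h‖ₑ ≠ ∞ := by
  refine ne_top_of_le_ne_top (hM.tsum_ne_top π) (ENNReal.tsum_le_tsum fun h => ?_)
  rw [enorm_gamma_pow_mul]
  gcongr
  exact M.enorm_histReward_le π h

lemma summable (hM : M.UniformlyConvergent) :
    Summable fun h : CIRLHistory S AH AR => M.γ ^ h.time * M.histReward π h :=
  Summable.of_enorm (hM.summable_enorm π)

end UniformlyConvergent

end CIRLGame

/-! ### Uniform tightness and continuity of the value -/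

/-- The policy pair that plays a sequence of joint actions, whatever is observed. -/
def CIRLPolicyPair.openLoop {S AH AR Θ : Type*} [MeasurableSpace Θ] (α : ℕ → AH × AR) :
    CIRLPolicyPair S AH AR Θ where
  human h _ := (α h.time).1
  robot h := (α h.time).2
  measurableSet_human _ _ := MeasurableSet.const _

namespace CIRLGame

open CIRLHistory CIRLPolicyPair

variable {S AH AR Θ : Type*} [MeasurableSpace S] [MeasurableSpace Θ]
  (M : CIRLGame S AH AR Θ) (π : CIRLPolicyPair S AH AR Θ)

lemma likelihood_openLoop_congr {α β : ℕ → AH × AR} {x : S × Θ} {h : CIRLHistory S AH AR}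
    (hαβ : ∀ n < h.time, α n = β n) :
    M.likelihood (openLoop α) x h = M.likelihood (openLoop β) x h :=
  likelihood_congr fun p _ hp => by simp [openLoop, hαβ _ hp]

/-- A given history, followed by given actions, is at least as likely under some open-loop policy
pair as under any other policy pair. -/
lemma exists_likelihood_le_openLoop (h : CIRLHistory S AH AR) (a : AH × AR) :
    ∃ α : ℕ → AH × AR, α h.time = a ∧
      ∀ (π : CIRLPolicyPair S AH AR Θ) x, M.likelihood π x h ≤ M.likelihood (openLoop α) x h := by
  classical
  induction h generalizing a with
  | start s => exact ⟨fun _ => a, rfl, fun π x => by simp only [likelihood_start, le_refl]⟩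
  | step h aH aR s ih =>
    obtain ⟨α, hα, hle⟩ := ih (aH, aR)
    -- The longer history needs `(aH, aR)` at time `h.time`, which `α` already plays; the prescribed
    -- `a` comes one step later and does not affect the likelihood.
    refine ⟨Function.update α (h.time + 1) a, Function.update_self .., fun π x => ?_⟩
    have hlt : ∀ n, n < h.time + 1 → Function.update α (h.time + 1) a n = α n := fun n hn =>
      Function.update_of_ne hn.ne _ _
    rw [likelihood_step, likelihood_step, M.likelihood_openLoop_congr (β := α) (h := h) fun n hn =>
      hlt n (hn.trans (Nat.lt_succ_self _))]
    refine mul_le_mul' (hle π x) ?_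
    simp only [openLoop, hlt _ (Nat.lt_succ_self _), hα, and_self, if_true]
    split_ifs <;> simp

lemma gamma_pow_le_one (t : ℕ) : ENNReal.ofReal (M.γ ^ t) ≤ 1 := by
  rw [← ENNReal.ofReal_one]
  exact ENNReal.ofReal_le_ofReal (pow_le_one₀ M.γ_nonneg M.γ_le_one)

section Tightness

variable [MeasurableSingletonClass S] [Finite AH]

/-- The bound does not depend on `π`. The human's last action may vary with `θ`, so it is bounded by
the sum over all actions `a`; each summand is dominated by an open-loop pair. Only times up to `N`
matter, which leaves finitely many open-loop pairs. The outer sum over `AH` merely counts the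
actions `a`. -/
lemma histAbsReward_le_tsum_openLoop {N : ℕ} {h : CIRLHistory S AH AR} (hN : h.time ≤ N) :
    M.histAbsReward π h ≤ ∑' _ : AH, ∑' α : Fin (N + 1) → AH × AR,
      M.histAbsReward (openLoop fun n => α (Fin.ofNat (N + 1) n)) h := by
  have key : ∀ a : AH, ∫⁻ x, M.likelihood π x h * ‖M.R h.current a (π.robot h) x.2‖ₑ ∂M.P₀ ≤
      ∑' α : Fin (N + 1) → AH × AR,
        M.histAbsReward (openLoop fun n => α (Fin.ofNat (N + 1) n)) h := by
    intro a
    obtain ⟨α, hα, hle⟩ := M.exists_likelihood_le_openLoop (Θ := Θ) h (a, π.robot h)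
    refine le_trans ?_ (ENNReal.le_tsum fun n : Fin (N + 1) => α n)
    refine lintegral_mono fun x => ?_
    -- `Fin.ofNat` reduces modulo `N + 1`, hence is the identity on the relevant times.
    have hval : ∀ n ≤ h.time, α ((Fin.ofNat (N + 1) n : Fin (N + 1)) : ℕ) = α n := fun n hn => by
      rw [Fin.val_ofNat, Nat.mod_eq_of_lt (by omega)]
    refine mul_le_mul' ((hle π x).trans_eq (M.likelihood_openLoop_congr fun n hn =>
      (hval n hn.le).symm)) (le_of_eq ?_)
    simp only [reward, openLoop]
    rw [hval _ le_rfl, hα]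
  refine le_trans ?_ (ENNReal.tsum_le_tsum key)
  have hm : ∀ a : AH, Measurable fun x : S × Θ =>
      M.likelihood π x h * ‖M.R h.current a (π.robot h) x.2‖ₑ := fun a =>
    (M.measurable_likelihood π h).mul ((M.measurable_R _ _ _).comp measurable_snd).enorm
  rw [← lintegral_tsum fun a => (hm a).aemeasurable]
  exact lintegral_mono fun x => ENNReal.le_tsum (f := fun a =>
    M.likelihood π x h * ‖M.R h.current a (π.robot h) x.2‖ₑ) (π.human h x.2)

variable [Countable S] [Finite AR]
variable {M}

open Classical in
/-- Up to `ε`, the discounted expected absolute reward is received after finitely many histories,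
uniformly in the policies. -/
lemma UniformlyConvergent.exists_finset (hM : M.UniformlyConvergent) {ε : ℝ≥0∞} (hε : ε ≠ 0) :
    ∃ A : Finset (CIRLHistory S AH AR), ∀ π : CIRLPolicyPair S AH AR Θ,
      ∑' h : {h // h ∉ A}, ENNReal.ofReal (M.γ ^ h.1.time) * M.histAbsReward π h ≤ ε := by
  have hε2 : 0 < ε / 2 := ENNReal.half_pos hε
  obtain ⟨N, hN⟩ := (hM.tendsto_tail.eventually_lt_const hε2).exists
  -- A summable majorant, common to all policy pairs, for the histories before time `N`; the later
  -- ones are covered by the uniform tail bound.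
  set D : CIRLHistory S AH AR → ℝ≥0∞ := fun h => if h.time < N then
    ∑' _ : AH, ∑' α : Fin (N + 1) → AH × AR,
      M.histAbsReward (openLoop fun n => α (Fin.ofNat (N + 1) n)) h else 0 with hD
  have hDsum : ∑' h, D h ≠ ∞ := by
    have e : ∑' h, D h = ∑' _ : AH, ∑' α : Fin (N + 1) → AH × AR,
        ∑ t ∈ Finset.range N, M.expAbsReward (openLoop fun n => α (Fin.ofNat (N + 1) n)) t := by
      have e1 : ∀ h, D h = ∑' _ : AH, ∑' α : Fin (N + 1) → AH × AR,
          (if h.time < N then (1 : ℝ≥0∞) else 0) *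
            M.histAbsReward (openLoop fun n => α (Fin.ofNat (N + 1) n)) h := by
        intro h
        simp only [hD]
        split_ifs <;> simp
      simp only [e1]
      rw [ENNReal.tsum_comm]
      refine tsum_congr fun _ => ?_
      rw [ENNReal.tsum_comm]
      refine tsum_congr fun α => ?_
      rw [← M.tsum_mul_expAbsReward _ fun t => if t < N then 1 else 0, tsum_eq_sum
        (s := Finset.range N)]
      · exact Finset.sum_congr rfl fun t ht => by simp [Finset.mem_range.1 ht]
      · intro t ht
        simp [Finset.mem_range.not.1 ht]
    have := Fintype.ofFinite AH
    have := Fintype.ofFinite AR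
    rw [e, tsum_fintype]
    refine ENNReal.sum_ne_top.2 fun _ _ => ?_
    rw [tsum_fintype]
    exact ENNReal.sum_ne_top.2 fun α _ => ENNReal.sum_ne_top.2 fun t _ =>
      (hM.expAbsReward_lt_top _ t).ne
  obtain ⟨A, hA⟩ := ((ENNReal.tendsto_tsum_compl_atTop_zero hDsum).eventually_lt_const
    hε2).exists
  refine ⟨A, fun π => ?_⟩
  calc ∑' h : {h // h ∉ A}, ENNReal.ofReal (M.γ ^ h.1.time) * M.histAbsReward π h
      ≤ ∑' h : {h // h ∉ A}, (D h + if N ≤ h.1.time then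
          ENNReal.ofReal (M.γ ^ h.1.time) * M.histAbsReward π h.1 else 0) := by
        refine ENNReal.tsum_le_tsum fun h => ?_
        by_cases hn : N ≤ h.1.time
        · simp [hn]
        · simp only [hD, not_le.1 hn, if_true, hn, if_false, add_zero]
          calc _ ≤ 1 * M.histAbsReward π h.1 := by gcongr; exact M.gamma_pow_le_one _
            _ ≤ _ := by
              rw [one_mul]
              exact M.histAbsReward_le_tsum_openLoop π (by omega)
    _ = ∑' h : {h // h ∉ A}, D h + ∑' h : {h // h ∉ A}, (if N ≤ h.1.time then
          ENNReal.ofReal (M.γ ^ h.1.time) * M.histAbsReward π h.1 else 0) := ENNReal.tsum_add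
    _ ≤ ε / 2 + ε / 2 := by
        refine add_le_add hA.le (le_trans (ENNReal.tsum_comp_le_tsum_of_injective
          Subtype.val_injective fun h => if N ≤ h.time then
          ENNReal.ofReal (M.γ ^ h.time) * M.histAbsReward π h else 0) ?_)
        rw [← M.tsum_tail_eq π fun t => ENNReal.ofReal (M.γ ^ t)]
        exact (le_iSup (fun π => ∑' t : ℕ,
          ENNReal.ofReal (M.γ ^ (N + t)) * M.expAbsReward π (N + t)) π).trans hN.le
    _ = ε := ENNReal.add_halves ε

/-- The value is uniformly continuous in the policies, for the topology of pointwise convergence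
on histories. -/
lemma UniformlyConvergent.exists_finset_abs_value_sub_le (hM : M.UniformlyConvergent) {ε : ℝ}
    (hε : 0 < ε) :
    ∃ A : Finset (CIRLHistory S AH AR), ∀ π π' : CIRLPolicyPair S AH AR Θ,
      (∀ h ∈ A, π.human h = π'.human h ∧ π.robot h = π'.robot h) →
        |M.value π - M.value π'| ≤ ε := by
  classical
  obtain ⟨A, hA⟩ := hM.exists_finset (ε := ENNReal.ofReal (ε / 2))
    (ENNReal.ofReal_pos.2 (half_pos hε)).ne'
  -- The contribution of `h` depends on the decisions at all its initial segments, so `A` is closed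
  -- under them.
  have hfin : (⋃ h ∈ A, h.prefixes).Finite :=
    A.finite_toSet.biUnion fun h _ => h.finite_prefixes
  refine ⟨hfin.toFinset, fun π π' hag => ?_⟩
  have hcongr : ∀ h ∈ A, M.histReward π h = M.histReward π' h := fun h hh =>
    histReward_congr fun p hp => hag p (hfin.mem_toFinset.2 (Set.mem_biUnion hh hp))
  have tail : ∀ ρ : CIRLPolicyPair S AH AR Θ,
      |∑' h : {h // h ∉ A}, M.γ ^ h.1.time * M.histReward ρ h| ≤ ε / 2 := by
    intro ρ
    rw [← Real.norm_eq_abs, ← ENNReal.ofReal_le_ofReal_iff (half_pos hε).le, ofReal_norm]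
    refine enorm_tsum_le_tsum_enorm.trans (le_trans (ENNReal.tsum_le_tsum fun h => ?_) (hA ρ))
    rw [enorm_gamma_pow_mul]
    gcongr
    exact M.enorm_histReward_le ρ h
  have split : ∀ ρ : CIRLPolicyPair S AH AR Θ, M.value ρ =
      ∑ h ∈ A, M.γ ^ h.time * M.histReward ρ h +
        ∑' h : {h // h ∉ A}, M.γ ^ h.1.time * M.histReward ρ h := fun ρ => by
    rw [hM.value_eq ρ, (hM.summable ρ).sum_add_tsum_subtype_compl]
  rw [split π, split π', Finset.sum_congr rfl fun h hh => by
    rw [hcongr h hh], add_sub_add_left_eq_sub]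
  have h1 := abs_le.1 (tail π)
  have h2 := abs_le.1 (tail π')
  exact abs_le.2 ⟨by linarith, by linarith⟩

end Tightness

end CIRLGame

/-! ### Measurable selection of cluster points -/

section Selection

variable {X H A : Type*} [MeasurableSpace X] [Finite A]

/-- Pigeonhole: at each `x` some value is taken infinitely often along the indices `n` with `x ∈ E
n`. Taking the first such value in an enumeration of `A` makes the choice measurable. -/
lemma exists_measurable_frequently_eq {E : ℕ → Set X} (hE : ∀ n, MeasurableSet (E n))
    (hfreq : ∀ x, ∃ᶠ n in atTop, x ∈ E n) {f : ℕ → X → A}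
    (hf : ∀ n a, MeasurableSet {x | f n x = a}) :
    ∃ g : X → A, (∀ a, MeasurableSet {x | g x = a}) ∧
      ∀ x, ∃ᶠ n in atTop, x ∈ E n ∧ f n x = g x := by
  classical
  rcases isEmpty_or_nonempty X with hX | ⟨⟨x₀⟩⟩
  · exact ⟨fun x => isEmptyElim x, fun a => Subsingleton.measurableSet, fun x => isEmptyElim x⟩
  have : Nonempty A := ⟨f 0 x₀⟩
  obtain ⟨e, he⟩ := exists_surjective_nat A
  have hex : ∀ x, ∃ k, ∃ᶠ n in atTop, x ∈ E n ∧ f n x = e k := by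
    intro x
    obtain ⟨a, ha⟩ := frequently_exists.1 ((hfreq x).mono fun n hn =>
      (⟨f n x, hn, rfl⟩ : ∃ a, x ∈ E n ∧ f n x = a))
    obtain ⟨k, rfl⟩ := he a
    exact ⟨k, ha⟩
  have hmeas : ∀ k, MeasurableSet {x | ∃ᶠ n in atTop, x ∈ E n ∧ f n x = e k} := by
    intro k
    simp only [frequently_atTop, Set.ofPred_forall, Set.ofPred_exists, Set.ofPred_and]
    exact MeasurableSet.iInter fun m => MeasurableSet.iUnion fun n =>
      (MeasurableSet.const _).inter ((hE n).inter (hf n (e k)))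
  refine ⟨fun x => e (Nat.find (hex x)), fun a => ?_, fun x => Nat.find_spec (hex x)⟩
  exact measurable_find hex hmeas (MeasurableSet.of_discrete (s := {k | e k = a}))

/-- A sequence of measurable families of elements of a finite set has a measurable cluster
point. -/
lemma exists_measurable_cluster [Countable H] {q : ℕ → X → H → A}
    (hq : ∀ n h a, MeasurableSet {x | q n x h = a}) :
    ∃ g : X → H → A, (∀ h a, MeasurableSet {x | g x h = a}) ∧
      ∀ x (F : Finset H), ∃ᶠ n in atTop, ∀ h ∈ F, q n x h = g x h := by
  classical
  rcases isEmpty_or_nonempty H with hH | hH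
  · exact ⟨fun x h => isEmptyElim h, fun h => isEmptyElim h, fun x F =>
      (Eventually.of_forall fun n h => isEmptyElim h).frequently⟩
  obtain ⟨e, he⟩ := exists_surjective_nat H
  -- `E n` is the set of points for which the index `n` is still kept. Such a sequence of sets
  -- encodes a subsequence that depends on the point, refined once for each element of `H`.
  let Good : Set (ℕ → Set X) := {E | (∀ n, MeasurableSet (E n)) ∧ ∀ x, ∃ᶠ n in atTop, x ∈ E n}
  have hstep : ∀ (E : Good) (h : H), ∃ g : X → A, (∀ a, MeasurableSet {x | g x = a}) ∧
      ∀ x, ∃ᶠ n in atTop, x ∈ E.1 n ∧ q n x h = g x := fun E h =>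
    exists_measurable_frequently_eq E.2.1 E.2.2 fun n a => hq n h a
  choose g hg hfreq using hstep
  have hnext : ∀ (E : Good) (h : H), (fun n => E.1 n ∩ {x | q n x h = g E h x}) ∈ Good := by
    refine fun E h => ⟨fun n => (E.2.1 n).inter ?_, hfreq E h⟩
    have : {x | q n x h = g E h x} = ⋃ a, {x | q n x h = a} ∩ {x | g E h x = a} := by
      ext x
      simp [eq_comm]
    rw [this]
    exact MeasurableSet.iUnion fun a => (hq n h a).inter (hg E h a)
  let E : ℕ → Good := fun k => Nat.rec ⟨fun _ => Set.univ, fun _ => MeasurableSet.univ,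
    fun x => (Eventually.of_forall fun _ => Set.mem_univ x).frequently⟩
    (fun k E => ⟨_, hnext E (e k)⟩) k
  have hmem : ∀ k n x, x ∈ (E k).1 n → ∀ j < k, q n x (e j) = g (E j) (e j) x := by
    intro k
    induction k with
    | zero => intro n x _ j hj; omega
    | succ k ih =>
      intro n x hx j hj
      rcases Nat.lt_succ_iff_lt_or_eq.1 hj with hj | rfl
      · exact ih n x hx.1 j hj
      · exact hx.2
  let i : H → ℕ := Function.surjInv he
  refine ⟨fun x h => g (E (i h)) (e (i h)) x, fun h a => hg _ _ a, fun x F => ?_⟩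
  -- Stage `k` controls only the coordinates `j < k`, hence the `+ 1`.
  refine ((E (F.sup i + 1)).2.2 x).mono fun n hn h hh => ?_
  have := hmem _ n x hn (i h) (Nat.lt_succ_of_le (Finset.le_sup hh))
  rw [Function.surjInv_eq he h] at this
  simpa only [Function.surjInv_eq he h, i] using this

end Selection

/-! ### Best responses and existence of optimal policy pairs -/

namespace CIRLPolicyPair

open CIRLHistory

variable {S AH AR Θ : Type*} [MeasurableSpace S] [MeasurableSpace Θ]

/-- The human selects one of countably many policies as a function of the initial state and the
reward parameter, while the robot plays `r`. -/
def paste (ρ : ℕ → CIRLPolicyPair S AH AR Θ) {N : S × Θ → ℕ} (hN : Measurable N)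
    (r : CIRLHistory S AH AR → AR) : CIRLPolicyPair S AH AR Θ where
  human h θ := (ρ (N (h.init, θ))).human h θ
  robot := r
  measurableSet_human h a := by
    have : {θ | (ρ (N (h.init, θ))).human h θ = a} =
        ⋃ n, {θ | N (h.init, θ) = n} ∩ {θ | (ρ n).human h θ = a} := by
      ext θ
      simp
    rw [this]
    exact MeasurableSet.iUnion fun n =>
      ((hN.comp measurable_prodMk_left) (measurableSet_singleton n)).inter
        ((ρ n).measurableSet_human h a)

/-- The policy pair with the robot's policy replaced by `r`. -/
def withRobot (π : CIRLPolicyPair S AH AR Θ) (r : CIRLHistory S AH AR → AR) :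
    CIRLPolicyPair S AH AR Θ :=
  { π with robot := r }

end CIRLPolicyPair

namespace CIRLGame

open CIRLHistory CIRLPolicyPair

variable {S AH AR Θ : Type*} [MeasurableSpace S] [MeasurableSpace Θ]
  (M : CIRLGame S AH AR Θ) (π : CIRLPolicyPair S AH AR Θ)

/-- The expected discounted return given the initial state and the reward parameter. -/
noncomputable def pathValue (x : S × Θ) : ℝ :=
  ∑' h : CIRLHistory S AH AR,
    M.γ ^ h.time * ((M.likelihood π x h).toReal * M.reward π h x.2)

-- Given `x`, only histories starting at `x.1` have positive likelihood, and only the human's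
-- decisions at the parameter `x.2` enter. The human may therefore optimize separately at each `x`,
-- for a fixed robot policy.
variable {M π} in
lemma pathValue_congr {π' : CIRLPolicyPair S AH AR Θ} {x : S × Θ}
    (hH : ∀ h, h.init = x.1 → π.human h x.2 = π'.human h x.2) (hR : π.robot = π'.robot) :
    M.pathValue π x = M.pathValue π' x := by
  refine tsum_congr fun h => ?_
  by_cases hx : h.init = x.1
  · rw [reward_congr (hH h hx) (congrFun hR h), likelihood_congr fun p hp _ =>
      ⟨hH p ((init_of_mem_prefixes hp).trans hx), congrFun hR p⟩]
  · rw [M.likelihood_eq_zero π hx, M.likelihood_eq_zero π' hx, ENNReal.toReal_zero, zero_mul,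
      zero_mul]

lemma pathValue_paste (ρ : ℕ → CIRLPolicyPair S AH AR Θ) {N : S × Θ → ℕ} (hN : Measurable N)
    {r : CIRLHistory S AH AR → AR} (hρ : ∀ n, (ρ n).robot = r) (x : S × Θ) :
    M.pathValue (paste ρ hN r) x = M.pathValue (ρ (N x)) x := by
  refine pathValue_congr (fun h hh => ?_) (hρ _).symm
  obtain ⟨s, θ⟩ := x
  obtain rfl : h.init = s := hh
  rfl

section

variable [MeasurableSingletonClass S] [Countable S] [Finite AH] [Finite AR]

lemma measurable_pathValue : Measurable (M.pathValue π) :=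
  Measurable.tsum fun h => (M.measurable_likelihood_mul_reward π h).const_mul _

namespace UniformlyConvergent

variable {M}

lemma tsum_lintegral_ne_top (hM : M.UniformlyConvergent) :
    ∑' h : CIRLHistory S AH AR, ∫⁻ x,
      ‖M.γ ^ h.time * ((M.likelihood π x h).toReal * M.reward π h x.2)‖ₑ ∂M.P₀ ≠ ∞ := by
  refine ne_top_of_le_ne_top (hM.tsum_ne_top π) (ENNReal.tsum_le_tsum fun h => ?_)
  simp only [enorm_gamma_pow_mul, enorm_likelihood_mul]
  rw [lintegral_const_mul _ (M.measurable_likelihood_mul_enorm π h), histAbsReward]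

lemma value_eq_integral (hM : M.UniformlyConvergent) :
    M.value π = ∫ x, M.pathValue π x ∂M.P₀ := by
  have h1 := integral_tsum (μ := M.P₀) (fun h : CIRLHistory S AH AR =>
    ((M.measurable_likelihood_mul_reward π h).const_mul (M.γ ^ h.time)).aestronglyMeasurable)
    (hM.tsum_lintegral_ne_top π)
  rw [hM.value_eq π]
  refine Eq.trans (tsum_congr fun h => ?_) h1.symm
  rw [integral_const_mul, histReward]

lemma integrable_pathValue (hM : M.UniformlyConvergent) : Integrable (M.pathValue π) M.P₀ := by
  refine ⟨(M.measurable_pathValue π).aestronglyMeasurable, lt_of_le_of_lt ?_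
    (hM.tsum_lintegral_ne_top π).lt_top⟩
  have h1 := lintegral_tsum (μ := M.P₀) (fun h : CIRLHistory S AH AR =>
    ((M.measurable_likelihood_mul_reward π h).const_mul (M.γ ^ h.time)).enorm.aemeasurable)
  rw [← h1]
  exact lintegral_mono fun x => enorm_tsum_le_tsum_enorm

/-- Outside a finite set of histories the total is at most 1; on that set the open-loop bounds
apply, uniformly in the policies. -/
lemma bddAbove_range_value (hM : M.UniformlyConvergent) :
    BddAbove (Set.range (M.value : CIRLPolicyPair S AH AR Θ → ℝ)) := by
  obtain ⟨A, hA⟩ := hM.exists_finset (ε := 1) one_ne_zero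
  have hfin : ∀ (ρ : CIRLPolicyPair S AH AR Θ) h, M.histAbsReward ρ h ≠ ∞ := fun ρ h => by
    refine ne_top_of_le_ne_top (hM.expAbsReward_lt_top ρ h.time).ne ?_
    rw [expAbsReward_eq_tsum]
    exact ENNReal.le_tsum (⟨h, rfl⟩ : (time ⁻¹' {h.time} : Set (CIRLHistory S AH AR)))
  have hbound : ∀ h, ∃ c : ℝ≥0∞, c ≠ ∞ ∧ ∀ ρ : CIRLPolicyPair S AH AR Θ,
      M.histAbsReward ρ h ≤ c := by
    intro h
    have := Fintype.ofFinite AH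
    have := Fintype.ofFinite AR
    refine ⟨_, ?_, fun ρ => M.histAbsReward_le_tsum_openLoop ρ le_rfl⟩
    rw [tsum_fintype]
    refine ENNReal.sum_ne_top.2 fun _ _ => ?_
    rw [tsum_fintype]
    exact ENNReal.sum_ne_top.2 fun α _ => hfin _ _
  choose c hc hcb using hbound
  refine ⟨(∑ h ∈ A, c h + 1).toReal, ?_⟩
  rintro _ ⟨ρ, rfl⟩
  refine (le_abs_self _).trans ?_
  rw [← Real.norm_eq_abs, ← toReal_enorm]
  refine ENNReal.toReal_mono (ENNReal.add_ne_top.2 ⟨ENNReal.sum_ne_top.2 fun h _ => hc h,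
    ENNReal.one_ne_top⟩) ?_
  rw [hM.value_eq ρ]
  refine enorm_tsum_le_tsum_enorm.trans ?_
  have hsplit : ∑ h ∈ A, ‖M.γ ^ h.time * M.histReward ρ h‖ₑ +
      ∑' h : {h // h ∉ A}, ‖M.γ ^ h.1.time * M.histReward ρ h.1‖ₑ =
      ∑' h, ‖M.γ ^ h.time * M.histReward ρ h‖ₑ := by
    rw [← Finset.tsum_subtype A fun h => ‖M.γ ^ h.time * M.histReward ρ h‖ₑ]
    exact Summable.tsum_add_tsum_compl (s := (A : Set (CIRLHistory S AH AR)))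
      (f := fun h => ‖M.γ ^ h.time * M.histReward ρ h‖ₑ) ENNReal.summable ENNReal.summable
  rw [← hsplit]
  refine add_le_add (Finset.sum_le_sum fun h _ => ?_)
    ((ENNReal.tsum_le_tsum fun h => ?_).trans (hA ρ))
  · rw [enorm_gamma_pow_mul]
    calc _ ≤ 1 * M.histAbsReward ρ h :=
          mul_le_mul' (M.gamma_pow_le_one _) (M.enorm_histReward_le ρ h)
      _ ≤ c h := by rw [one_mul]; exact hcb h ρ
  · rw [enorm_gamma_pow_mul]
    gcongr
    exact M.enorm_histReward_le ρ _

/-- The human has a best response to every policy of the robot. -/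
lemma exists_best_response [Nonempty AH] (hM : M.UniformlyConvergent)
    (r : CIRLHistory S AH AR → AR) :
    ∃ π : CIRLPolicyPair S AH AR Θ, π.robot = r ∧
      ∀ π' : CIRLPolicyPair S AH AR Θ, π'.robot = r → M.value π' ≤ M.value π := by
  classical
  let C : Set (CIRLPolicyPair S AH AR Θ) := {π | π.robot = r}
  have hC : C.Nonempty := ⟨⟨fun _ _ => Classical.arbitrary AH, r, fun _ _ => .const _⟩, rfl⟩
  have hbdd : BddAbove (M.value '' C) := hM.bddAbove_range_value.mono (Set.image_subset_range _ _)
  obtain ⟨u, -, hu, hmem⟩ := exists_seq_tendsto_sSup (hC.image M.value) hbdd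
  choose σ hσ hσu using hmem
  -- a maximizing sequence whose conditional values increase pointwise
  have hpair : ∀ ρ ∈ C, ∀ π ∈ C, ∃ τ ∈ C, ∀ x,
      M.pathValue ρ x ≤ M.pathValue τ x ∧ M.pathValue π x ≤ M.pathValue τ x := by
    intro ρ hρ π hπ
    have hN : Measurable fun x => if M.pathValue ρ x ≤ M.pathValue π x then 1 else 0 :=
      Measurable.ite (measurableSet_le (M.measurable_pathValue ρ) (M.measurable_pathValue π))
        (measurable_const (a := (1 : ℕ))) measurable_const
    refine ⟨paste (fun n => if n = 1 then π else ρ) hN r, rfl, fun x => ?_⟩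
    rw [M.pathValue_paste _ hN (fun n => by split_ifs; exacts [hπ, hρ])]
    by_cases hx : M.pathValue ρ x ≤ M.pathValue π x
    · simp [hx]
    · simp [hx, (not_le.1 hx).le]
  choose! join hjC hj using hpair
  let ρ : ℕ → CIRLPolicyPair S AH AR Θ := fun n => Nat.rec (σ 0) (fun n τ => join τ (σ (n + 1))) n
  have hρC : ∀ n, ρ n ∈ C := fun n => by
    induction n with
    | zero => exact hσ 0
    | succ n ih => exact hjC _ ih _ (hσ _)
  have hmono : ∀ x, Monotone fun n => M.pathValue (ρ n) x := fun x =>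
    monotone_nat_of_le_succ fun n => (hj _ (hρC n) _ (hσ _) x).1
  have hσρ : ∀ n x, M.pathValue (σ n) x ≤ M.pathValue (ρ n) x := fun n x => by
    cases n with
    | zero => exact le_rfl
    | succ n => exact (hj _ (hρC n) _ (hσ _) x).2
  -- a measurable cluster point
  obtain ⟨g, hg, hfreq⟩ := exists_measurable_cluster
    (q := fun n (x : S × Θ) (h : CIRLHistory S AH AR) => (ρ n).human h x.2)
    fun n h a => measurable_snd ((ρ n).measurableSet_human h a)
  let π : CIRLPolicyPair S AH AR Θ := ⟨fun h θ => g (h.init, θ) h, r, fun h a =>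
    measurable_prodMk_left (hg h a)⟩
  refine ⟨π, rfl, fun π' hπ' => (le_csSup hbdd ⟨π', hπ', rfl⟩).trans ?_⟩
  refine le_of_tendsto' hu fun k => le_of_forall_pos_le_add fun ε hε => ?_
  obtain ⟨A, hA⟩ := hM.exists_finset_abs_value_sub_le hε
  -- The index agreeing with the cluster point on `A` depends on `x`, so possibly no single `ρ n` is
  -- close to `π`. Pasting the least such index at each `x` is close to `π`, and it is worth at
  -- least `σ k` since the indices are at least `k`.
  have hex : ∀ x : S × Θ, ∃ n, k ≤ n ∧ ∀ h ∈ A, (ρ n).human h x.2 = g x h := fun x => by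
    obtain ⟨n, hn⟩ := frequently_atTop.1 (hfreq x A) k
    exact ⟨n, hn⟩
  have hN : Measurable fun x => Nat.find (hex x) := by
    refine measurable_find hex fun n => ?_
    have hInter : {x : S × Θ | k ≤ n ∧ ∀ h ∈ A, (ρ n).human h x.2 = g x h} =
        {_x | k ≤ n} ∩ ⋂ h ∈ A, {x | (ρ n).human h x.2 = g x h} := by
      ext x
      simp
    rw [hInter]
    refine (MeasurableSet.const _).inter (A.measurableSet_biInter fun h _ => ?_)
    have : {x : S × Θ | (ρ n).human h x.2 = g x h} =
        ⋃ a, {x | (ρ n).human h x.2 = a} ∩ {x | g x h = a} := by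
      ext x
      simp [eq_comm]
    rw [this]
    exact MeasurableSet.iUnion fun a =>
      (measurable_snd ((ρ n).measurableSet_human h a)).inter (hg h a)
  have hclose := hA (paste ρ hN r) π fun h hh =>
    ⟨funext fun θ => (Nat.find_spec (hex (h.init, θ))).2 h hh, rfl⟩
  have hge : M.value (σ k) ≤ M.value (paste ρ hN r) := by
    rw [hM.value_eq_integral, hM.value_eq_integral]
    refine integral_mono (hM.integrable_pathValue _) (hM.integrable_pathValue _) fun x => ?_
    rw [M.pathValue_paste _ hN hρC]
    exact (hσρ k x).trans (hmono x (Nat.find_spec (hex x)).1)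
  rw [← hσu k]
  have := (abs_le.1 hclose).2
  linarith

/-- Optimal policy pairs exist. -/
lemma exists_isOptimal [Nonempty AH] [Nonempty AR] (hM : M.UniformlyConvergent) :
    ∃ π : CIRLPolicyPair S AH AR Θ, M.IsOptimal π := by
  choose b hb hbest using hM.exists_best_response
  let _ : TopologicalSpace AR := ⊥
  have : DiscreteTopology AR := ⟨rfl⟩
  have hcont : Continuous fun r => M.value (b r) := by
    refine continuous_iff_continuousAt.2 fun r => Metric.tendsto_nhds.2 fun ε hε => ?_
    obtain ⟨A, hA⟩ := hM.exists_finset_abs_value_sub_le (half_pos hε)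
    filter_upwards [set_pi_mem_nhds A.finite_toSet (s := fun h => {r h}) (x := r)
      fun h _ => (isOpen_discrete _).mem_nhds rfl] with r' hr'
    -- Keep the human's reply to `r₁` and replace the robot by `r₂`: this costs at most `ε / 2`, and
    -- the best response to `r₂` does no worse.
    have key : ∀ r₁ r₂ : CIRLHistory S AH AR → AR, (∀ h ∈ A, r₁ h = r₂ h) →
        M.value (b r₁) ≤ M.value (b r₂) + ε / 2 := by
      intro r₁ r₂ he
      have h1 := hA (b r₁) ((b r₁).withRobot r₂) fun h hh =>
        ⟨rfl, (congrFun (hb r₁) h).trans (he h hh)⟩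
      have h2 := hbest r₂ ((b r₁).withRobot r₂) rfl
      have := (abs_le.1 h1).2
      linarith
    have h1 := key r' r fun h hh => hr' h hh
    have h2 := key r r' fun h hh => (hr' h hh).symm
    rw [Real.dist_eq]
    exact (abs_le.2 ⟨by linarith, by linarith⟩).trans_lt (half_lt_self hε)
  obtain ⟨r, -, hr⟩ := isCompact_univ.exists_isMaxOn Set.univ_nonempty hcont.continuousOn
  exact ⟨b r, fun π => (hbest π.robot π rfl).trans (hr (Set.mem_univ π.robot))⟩

end UniformlyConvergent

end

end CIRLGame

/-! ### Splitting histories at a given time -/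

namespace CIRLHistory

variable {S AH AR : Type*}

/-- The history `p`, continued as in `h`, whose initial state is meant to be the current state
of `p`. -/
def append (p : CIRLHistory S AH AR) : CIRLHistory S AH AR → CIRLHistory S AH AR
  | start _ => p
  | step h aH aR s => step (p.append h) aH aR s

/-- The part of a history up to time `N`. -/
def take (N : ℕ) : CIRLHistory S AH AR → CIRLHistory S AH AR
  | start s => start s
  | step h aH aR s => if h.time < N then step h aH aR s else h.take N

/-- The part of a history from time `N` on. -/
def drop (N : ℕ) : CIRLHistory S AH AR → CIRLHistory S AH AR
  | start s => start s
  | step h aH aR s => if h.time < N then start s else step (h.drop N) aH aR s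

lemma time_append (p h : CIRLHistory S AH AR) : (p.append h).time = p.time + h.time := by
  induction h with
  | start s => rfl
  | step h aH aR s ih => simp only [append, time, ih, add_assoc]

lemma current_append {p h : CIRLHistory S AH AR} (hp : h.init = p.current) :
    (p.append h).current = h.current := by
  cases h with
  | start s => exact hp.symm
  | step h aH aR s => rfl

lemma append_take_drop (N : ℕ) (h : CIRLHistory S AH AR) : (h.take N).append (h.drop N) = h := by
  induction h with
  | start s => rfl
  | step h aH aR s ih =>
    simp only [take, drop]
    split_ifs
    · rfl
    · rw [append, ih]

lemma init_drop (N : ℕ) (h : CIRLHistory S AH AR) : (h.drop N).init = (h.take N).current := by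
  induction h with
  | start s => rfl
  | step h aH aR s ih =>
    simp only [take, drop]
    split_ifs
    · rfl
    · exact ih

lemma time_take (N : ℕ) (h : CIRLHistory S AH AR) : (h.take N).time = min N h.time := by
  induction h with
  | start s => simp [take, time]
  | step h aH aR s ih =>
    simp only [take]
    split_ifs with hN
    · simp only [time]; omega
    · rw [ih]; simp only [time]; omega

lemma take_eq_self {N : ℕ} {h : CIRLHistory S AH AR} (hN : h.time ≤ N) : h.take N = h := by
  cases h with
  | start s => rfl
  | step h aH aR s => exact if_pos hN

lemma drop_eq_start {N : ℕ} {h : CIRLHistory S AH AR} (hN : h.time ≤ N) :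
    h.drop N = start h.current := by
  cases h with
  | start s => rfl
  | step h aH aR s => exact if_pos hN

lemma take_append (p h : CIRLHistory S AH AR) : (p.append h).take p.time = p := by
  induction h with
  | start s => exact take_eq_self le_rfl
  | step h aH aR s ih =>
    rw [append, take, if_neg, ih]
    rw [time_append]
    omega

lemma drop_append {p h : CIRLHistory S AH AR} (hp : h.init = p.current) :
    (p.append h).drop p.time = h := by
  induction h with
  | start s => rw [append, drop_eq_start le_rfl, ← hp]; rfl
  | step h aH aR s ih =>
    rw [append, drop, if_neg, ih hp]
    rw [time_append]
    omega

/-- Histories that pass through `p` correspond to histories that start at the current state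
of `p`. -/
def takeFiberEquiv (p : CIRLHistory S AH AR) :
    (take p.time ⁻¹' {p} : Set (CIRLHistory S AH AR)) ≃
      {h : CIRLHistory S AH AR // h.init = p.current} where
  toFun h := ⟨h.1.drop p.time, by rw [init_drop, show h.1.take p.time = p from h.2]⟩
  invFun h := ⟨p.append h.1, take_append p h.1⟩
  left_inv h := Subtype.ext (by
    have := append_take_drop p.time h.1
    rwa [show h.1.take p.time = p from h.2] at this)
  right_inv h := Subtype.ext (drop_append h.2)

end CIRLHistory

namespace CIRLPolicyPair

open CIRLHistory

variable {S AH AR Θ : Type*} [MeasurableSpace Θ]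

/-- The policy pair that `π` induces after the history `p`. -/
def shift (π : CIRLPolicyPair S AH AR Θ) (p : CIRLHistory S AH AR) :
    CIRLPolicyPair S AH AR Θ where
  human h θ := π.human (p.append h) θ
  robot h := π.robot (p.append h)
  measurableSet_human _ _ := π.measurableSet_human _ _

/-- The policy pair that plays `π` before time `N`, and `ρ p` after the history `p` of time
`N`. -/
def switch (N : ℕ) (π : CIRLPolicyPair S AH AR Θ)
    (ρ : CIRLHistory S AH AR → CIRLPolicyPair S AH AR Θ) : CIRLPolicyPair S AH AR Θ where
  human h := if h.time < N then π.human h else (ρ (h.take N)).human (h.drop N)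
  robot h := if h.time < N then π.robot h else (ρ (h.take N)).robot (h.drop N)
  measurableSet_human h a := by
    split_ifs
    exacts [π.measurableSet_human _ _, (ρ _).measurableSet_human _ _]

variable (π : CIRLPolicyPair S AH AR Θ) (ρ : CIRLHistory S AH AR → CIRLPolicyPair S AH AR Θ)

lemma switch_agree {N : ℕ} {h : CIRLHistory S AH AR} (hN : h.time < N) :
    (switch N π ρ).human h = π.human h ∧ (switch N π ρ).robot h = π.robot h :=
  ⟨if_pos hN, if_pos hN⟩

lemma shift_switch_agree {p h : CIRLHistory S AH AR} (hp : h.init = p.current) :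
    ((switch p.time π ρ).shift p).human h = (ρ p).human h ∧
      ((switch p.time π ρ).shift p).robot h = (ρ p).robot h := by
  have hN : ¬ (p.append h).time < p.time := by rw [time_append]; omega
  constructor
  · funext θ
    simp only [shift, switch, if_neg hN, take_append, drop_append hp]
  · simp only [shift, switch, if_neg hN, take_append, drop_append hp]

end CIRLPolicyPair

/-! ### Continuation games -/

namespace CIRLGame

open CIRLHistory CIRLPolicyPair

variable {S AH AR Θ : Type*} [MeasurableSpace S] [MeasurableSpace Θ]
  (M : CIRLGame S AH AR Θ) (π : CIRLPolicyPair S AH AR Θ)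

/-- The game that starts at the state `s`, with reward parameter distributed as `b`. -/
noncomputable def subgame (s : S) (b : Measure Θ) [IsProbabilityMeasure b] :
    CIRLGame S AH AR Θ where
  T := M.T
  R := M.R
  measurable_R := M.measurable_R
  P₀ := b.map (Prod.mk s)
  isProbabilityMeasure_P₀ := Measure.isProbabilityMeasure_map measurable_prodMk_left.aemeasurable
  γ := M.γ
  γ_nonneg := M.γ_nonneg
  γ_le_one := M.γ_le_one

lemma likelihood_subgame (s : S) (b : Measure Θ) [IsProbabilityMeasure b] (x : S × Θ)
    (h : CIRLHistory S AH AR) : (M.subgame s b).likelihood π x h = M.likelihood π x h := by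
  induction h with
  | start s => simp only [likelihood_start]
  | step h aH aR s' ih => rw [likelihood_step, likelihood_step, ih]; rfl

/-- Markov property: past `p`, transitions depend only on the current state, so the likelihood
factors at `p`. -/
lemma likelihood_append {p h : CIRLHistory S AH AR} (hp : h.init = p.current) (x : S × Θ) :
    M.likelihood π x (p.append h) =
      M.likelihood π x p * M.likelihood (π.shift p) (p.current, x.2) h := by
  induction h with
  | start s => rw [likelihood_start, if_pos (show s = p.current from hp), mul_one]; rfl
  | step h aH aR s ih =>
    rw [append, likelihood_step, likelihood_step, ih hp, current_append (h := h) hp, mul_assoc]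
    rfl

lemma reward_append {p h : CIRLHistory S AH AR} (hp : h.init = p.current) (θ : Θ) :
    M.reward π (p.append h) θ = M.reward (π.shift p) h θ := by
  simp only [reward, current_append hp, shift]

/-- The likelihood of `h` involves only moves made strictly before its time. Hence changing the
policies from time `N` on leaves all beliefs at time `N` intact. -/
lemma jointWith_congr {M : CIRLGame S AH AR Θ} {π π' : CIRLPolicyPair S AH AR Θ}
    {h : CIRLHistory S AH AR}
    (hp : ∀ p : CIRLHistory S AH AR, p.time < h.time →
      π.human p = π'.human p ∧ π.robot p = π'.robot p) :
    M.jointWith π h = M.jointWith π' h := by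
  have : ∀ x : S × Θ, M.historyLaw π x.1 x.2 h.time h = M.historyLaw π' x.1 x.2 h.time h := fun x =>
    likelihood_congr fun p _ ht => ⟨congrFun (hp p ht).1 x.2, (hp p ht).2⟩
  simp only [jointWith, this]

section Measurable

variable [MeasurableSingletonClass S]

lemma lintegral_jointWith (h : CIRLHistory S AH AR) {f : Θ → ℝ≥0∞} (hf : Measurable f) :
    ∫⁻ θ, f θ ∂M.jointWith π h = ∫⁻ x, M.likelihood π x h * f x.2 ∂M.P₀ := by
  rw [jointWith, lintegral_map hf measurable_snd]
  exact lintegral_withDensity_eq_lintegral_mul _ (M.measurable_likelihood π h)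
    (hf.comp measurable_snd)

lemma integral_jointWith (h : CIRLHistory S AH AR) {f : Θ → ℝ} (hf : Measurable f) :
    ∫ θ, f θ ∂M.jointWith π h = ∫ x, (M.likelihood π x h).toReal * f x.2 ∂M.P₀ := by
  rw [jointWith, integral_map measurable_snd.aemeasurable hf.aestronglyMeasurable]
  exact integral_withDensity_eq_integral_toReal_smul (M.measurable_likelihood π h)
    (Eventually.of_forall fun x => (M.likelihood_ne_top π x h).lt_top) _

lemma jointWith_univ_le_one (h : CIRLHistory S AH AR) : M.jointWith π h Set.univ ≤ 1 := by
  have := M.isProbabilityMeasure_P₀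
  rw [← lintegral_one, M.lintegral_jointWith π h measurable_const]
  calc _ ≤ ∫⁻ _, 1 ∂M.P₀ := lintegral_mono fun x => by
        rw [mul_one]; exact M.likelihood_le_one π x h
    _ = 1 := by simp

lemma jointWith_univ_ne_top (h : CIRLHistory S AH AR) : M.jointWith π h Set.univ ≠ ∞ :=
  ((M.jointWith_univ_le_one π h).trans_lt ENNReal.one_lt_top).ne

lemma isProbabilityMeasure_belief {h : CIRLHistory S AH AR}
    (hK : M.jointWith π h Set.univ ≠ 0) : IsProbabilityMeasure (M.belief π h) :=
  ⟨by simp [belief, ENNReal.inv_mul_cancel hK (M.jointWith_univ_ne_top π h)]⟩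

lemma jointWith_eq_smul_belief {h : CIRLHistory S AH AR} (hK : M.jointWith π h Set.univ ≠ 0) :
    M.jointWith π h = M.jointWith π h Set.univ • M.belief π h := by
  rw [belief, smul_smul, ENNReal.mul_inv_cancel hK (M.jointWith_univ_ne_top π h), one_smul]

variable [Finite AH]

lemma histReward_subgame (s : S) (b : Measure Θ) [IsProbabilityMeasure b]
    (h : CIRLHistory S AH AR) :
    (M.subgame s b).histReward π h =
      ∫ θ, (M.likelihood π (s, θ) h).toReal * M.reward π h θ ∂b := by
  refine Eq.trans (integral_map measurable_prodMk_left.aemeasurable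
    ((M.subgame s b).measurable_likelihood_mul_reward π h).aestronglyMeasurable) ?_
  simp only [likelihood_subgame]
  rfl

lemma histAbsReward_subgame (s : S) (b : Measure Θ) [IsProbabilityMeasure b]
    (h : CIRLHistory S AH AR) :
    (M.subgame s b).histAbsReward π h =
      ∫⁻ θ, M.likelihood π (s, θ) h * ‖M.reward π h θ‖ₑ ∂b := by
  refine Eq.trans (lintegral_map ((M.subgame s b).measurable_likelihood_mul_enorm π h)
    measurable_prodMk_left) ?_
  simp only [likelihood_subgame]
  rfl

lemma histReward_subgame_eq_zero {s : S} {b : Measure Θ} [IsProbabilityMeasure b]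
    {h : CIRLHistory S AH AR} (hs : h.init ≠ s) : (M.subgame s b).histReward π h = 0 := by
  simp [histReward_subgame, M.likelihood_eq_zero π (x := (s, _)) hs]

lemma histAbsReward_subgame_eq_zero {s : S} {b : Measure Θ} [IsProbabilityMeasure b]
    {h : CIRLHistory S AH AR} (hs : h.init ≠ s) : (M.subgame s b).histAbsReward π h = 0 := by
  simp [histAbsReward_subgame, M.likelihood_eq_zero π (x := (s, _)) hs]

lemma histReward_append {p h : CIRLHistory S AH AR} (hp : h.init = p.current) :
    M.histReward π (p.append h) =
      ∫ θ, (M.likelihood (π.shift p) (p.current, θ) h).toReal * M.reward (π.shift p) h θ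
        ∂M.jointWith π p := by
  have hm : Measurable fun θ =>
      (M.likelihood (π.shift p) (p.current, θ) h).toReal * M.reward (π.shift p) h θ :=
    ((M.measurable_likelihood _ h).comp measurable_prodMk_left).ennreal_toReal.mul
      (M.measurable_reward _ h)
  rw [integral_jointWith _ _ _ hm]
  simp only [histReward, M.likelihood_append π hp, M.reward_append π hp, ENNReal.toReal_mul,
    mul_assoc]

lemma histAbsReward_append {p h : CIRLHistory S AH AR} (hp : h.init = p.current) :
    M.histAbsReward π (p.append h) =
      ∫⁻ θ, M.likelihood (π.shift p) (p.current, θ) h * ‖M.reward (π.shift p) h θ‖ₑ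
        ∂M.jointWith π p := by
  have hm : Measurable fun θ =>
      M.likelihood (π.shift p) (p.current, θ) h * ‖M.reward (π.shift p) h θ‖ₑ :=
    ((M.measurable_likelihood _ h).comp measurable_prodMk_left).mul
      (M.measurable_reward _ h).enorm
  rw [lintegral_jointWith _ _ _ hm]
  simp only [histAbsReward, M.likelihood_append π hp, M.reward_append π hp, mul_assoc]

variable {M π}

lemma histReward_append_eq_mul {p h : CIRLHistory S AH AR} {K : ℝ≥0∞} {b : Measure Θ}
    [IsProbabilityMeasure b] (hb : M.jointWith π p = K • b) (hp : h.init = p.current) :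
    M.histReward π (p.append h) =
      K.toReal * (M.subgame p.current b).histReward (π.shift p) h := by
  rw [M.histReward_append π hp, hb, integral_smul_measure, histReward_subgame, smul_eq_mul]

lemma histAbsReward_append_eq_mul {p h : CIRLHistory S AH AR} {K : ℝ≥0∞} {b : Measure Θ}
    [IsProbabilityMeasure b] (hb : M.jointWith π p = K • b) (hp : h.init = p.current) :
    M.histAbsReward π (p.append h) =
      K * (M.subgame p.current b).histAbsReward (π.shift p) h := by
  rw [M.histAbsReward_append π hp, hb, lintegral_smul_measure, histAbsReward_subgame, smul_eq_mul]

variable [Countable S] [Finite AR]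

/-- Let `M` be played with a switch to `ρ` at the time of `p`. The histories through `p` contribute
`K` times what `ρ` earns in the continuation game, and all others contribute nonnegatively. The
weight `w` serves to isolate either a single time or a discounted tail. -/
lemma mul_tsum_subgame_le {p : CIRLHistory S AH AR} {K : ℝ≥0∞} {b : Measure Θ}
    [IsProbabilityMeasure b] (hb : M.jointWith π p = K • b) (ρ : CIRLPolicyPair S AH AR Θ)
    (w : ℕ → ℝ≥0∞) :
    K * ∑' t, w t * (M.subgame p.current b).expAbsReward ρ t ≤
      ∑' t, w t * M.expAbsReward (switch p.time π fun _ => ρ) (p.time + t) := by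
  classical
  set π' := switch p.time π fun _ => ρ with hπ'
  have hb' : M.jointWith π' p = K • b := by
    rw [← hb]
    exact jointWith_congr fun q hq => switch_agree π _ hq
  have hR := M.tsum_tail_eq π' (fun t => w (t - p.time)) p.time
  simp only [Nat.add_sub_cancel_left] at hR
  rw [hR, tsum_mul_expAbsReward, ← ENNReal.tsum_mul_left,
    ← tsum_subtype_eq_of_support_subset (s := {h : CIRLHistory S AH AR | h.init = p.current})]
  · let i : {h : CIRLHistory S AH AR | h.init = p.current} → CIRLHistory S AH AR :=
      fun h => p.append h.1
    have hi : Function.Injective i := fun h h' e => Subtype.ext (by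
      rw [← drop_append h.2, ← drop_append h'.2]
      exact congrArg (drop p.time) e)
    refine le_trans (ENNReal.tsum_le_tsum fun h => ?_)
      (ENNReal.tsum_comp_le_tsum_of_injective hi _)
    simp only [i, time_append, Nat.add_sub_cancel_left, Nat.le_add_right, if_true]
    rw [histAbsReward_append_eq_mul hb' h.2, mul_left_comm,
      histAbsReward_congr (π := π'.shift p) (π' := ρ) fun q hq =>
        shift_switch_agree π _ ((init_of_mem_prefixes hq).trans h.2)]
  · intro h hh
    by_contra hn
    exact hh (by simp only [M.histAbsReward_subgame_eq_zero ρ hn, mul_zero])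

/-- The continuation of a game after a history of positive probability is again well defined. -/
lemma UniformlyConvergent.subgame (hM : M.UniformlyConvergent) {p : CIRLHistory S AH AR}
    {K : ℝ≥0∞} (hK : K ≠ 0) (hK' : K ≠ ∞) {b : Measure Θ} [IsProbabilityMeasure b]
    (hb : M.jointWith π p = K • b) :
    (CIRLGame.subgame M p.current b : CIRLGame S AH AR Θ).UniformlyConvergent := by
  classical
  constructor
  · intro ρ t
    have h1 := mul_tsum_subgame_le hb ρ fun k => if k = t then 1 else 0
    simp only [ite_mul, one_mul, zero_mul, tsum_ite_eq] at h1
    refine lt_top_iff_ne_top.2 fun htop => ?_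
    rw [htop, ENNReal.mul_top hK, top_le_iff] at h1
    exact (hM.expAbsReward_lt_top _ _).ne h1
  -- The comparison with tails of `M` divides by `γ ^ p.time`, so `γ = 0` is treated apart; there
  -- the tails vanish from `n = 1` on.
  · rcases eq_or_lt_of_le M.γ_nonneg with h0 | h0
    · refine tendsto_const_nhds.congr' ?_
      filter_upwards [eventually_ge_atTop 1] with n hn
      refine (ENNReal.iSup_eq_zero.2 fun ρ => ENNReal.tsum_eq_zero.2 fun t => ?_).symm
      rw [show (M.subgame p.current b).γ = 0 from h0.symm, zero_pow (by omega)]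
      simp
    · have hc : ENNReal.ofReal (M.γ ^ p.time) * K ≠ 0 :=
        mul_ne_zero (ENNReal.ofReal_pos.2 (pow_pos h0 _)).ne' hK
      have hc' : ENNReal.ofReal (M.γ ^ p.time) * K ≠ ∞ :=
        ENNReal.mul_ne_top ENNReal.ofReal_ne_top hK'
      have hlim := ENNReal.Tendsto.const_mul
        (a := (ENNReal.ofReal (M.γ ^ p.time) * K)⁻¹)
        (hM.tendsto_tail.comp (tendsto_add_atTop_nat p.time))
        (Or.inr (ENNReal.inv_ne_top.2 hc))
      rw [mul_zero] at hlim
      refine tendsto_of_tendsto_of_tendsto_of_le_of_le tendsto_const_nhds hlim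
        (fun _ => zero_le) fun n => iSup_le fun ρ => ?_
      rw [← ENNReal.inv_mul_le_iff (ENNReal.inv_ne_zero.2 hc') (ENNReal.inv_ne_top.2 hc), inv_inv]
      refine le_trans ?_ (le_iSup _ (switch p.time π fun _ => ρ))
      have h1 := mul_tsum_subgame_le hb ρ fun k =>
        if n ≤ k then ENNReal.ofReal (M.γ ^ k) else 0
      simp only [ite_mul, zero_mul] at h1
      rw [← ENNReal.tsum_add_eq_tsum_ite (fun k => ENNReal.ofReal (M.γ ^ k) *
          (M.subgame p.current b).expAbsReward ρ k),
        ← ENNReal.tsum_add_eq_tsum_ite (fun k => ENNReal.ofReal (M.γ ^ k) *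
          M.expAbsReward (switch p.time π fun _ => ρ) (p.time + k))] at h1
      rw [mul_assoc]
      refine (mul_le_mul_right h1 _).trans_eq ?_
      rw [← ENNReal.tsum_mul_left]
      refine tsum_congr fun t => ?_
      rw [← mul_assoc, ← ENNReal.ofReal_mul (M.gamma_pow_nonneg _), ← pow_add,
        show n + p.time + t = p.time + (n + t) by omega]

end Measurable

end CIRLGame

/-! ### Switching to optimal continuations -/

namespace CIRLGame

open CIRLHistory CIRLPolicyPair

variable {S AH AR Θ : Type*} [MeasurableSpace S] [MeasurableSpace Θ]
  {M : CIRLGame S AH AR Θ} {π : CIRLPolicyPair S AH AR Θ}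

section Switch

variable [MeasurableSingletonClass S] [Countable S] [Finite AH] [Finite AR]

/-- Histories through `p` are the continuations of `p`, so their share of the value is that of the
continuation game, scaled by the discount and the probability of `p`. -/
lemma UniformlyConvergent.tsum_fiber_eq (hM : M.UniformlyConvergent) {p : CIRLHistory S AH AR}
    {K : ℝ≥0∞} (hK : K ≠ 0) (hK' : K ≠ ∞) {b : Measure Θ} [IsProbabilityMeasure b]
    (hb : M.jointWith π p = K • b) :
    ∑' h : (take p.time ⁻¹' {p} : Set (CIRLHistory S AH AR)),
      M.γ ^ h.1.time * M.histReward π h =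
    M.γ ^ p.time * K.toReal * (M.subgame p.current b).value (π.shift p) := by
  rw [(hM.subgame hK hK' hb).value_eq, ← (takeFiberEquiv p).symm.tsum_eq, ← tsum_mul_left,
    ← tsum_subtype_eq_of_support_subset (s := {h : CIRLHistory S AH AR | h.init = p.current})]
  · refine tsum_congr fun h => ?_
    rw [show ((takeFiberEquiv p).symm h : CIRLHistory S AH AR) = p.append h.1 from rfl,
      time_append, pow_add, histReward_append_eq_mul hb h.2,
      show (M.subgame p.current b).γ = M.γ from rfl]
    ring
  · intro h hh
    by_contra hn
    exact hh (by simp only [M.histReward_subgame_eq_zero _ hn, mul_zero])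

/-- Switching to optimal policy pairs of the continuation games at time `N` does not decrease the
value. -/
lemma UniformlyConvergent.value_le_value_switch (hM : M.UniformlyConvergent) (N : ℕ)
    {ρ : CIRLHistory S AH AR → CIRLPolicyPair S AH AR Θ}
    (hρ : ∀ p : CIRLHistory S AH AR, p.time = N →
      ∀ _ : IsProbabilityMeasure (M.belief π p),
        (M.subgame p.current (M.belief π p)).UniformlyConvergent →
        (M.subgame p.current (M.belief π p)).IsOptimal (ρ p)) :
    M.value π ≤ M.value (switch N π ρ) := by
  set π' := switch N π ρ with hπ'
  rw [hM.value_eq π, hM.value_eq π', ← ((hM.summable π).hasSum.tsum_fiberwise (take N)).tsum_eq,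
    ← ((hM.summable π').hasSum.tsum_fiberwise (take N)).tsum_eq]
  refine ((hM.summable π).hasSum.tsum_fiberwise (take N)).summable.tsum_le_tsum (fun p => ?_)
    ((hM.summable π').hasSum.tsum_fiberwise (take N)).summable
  by_cases hp : p.time = N
  · subst hp
    have hj : M.jointWith π' p = M.jointWith π p :=
      jointWith_congr fun q hq => switch_agree π ρ hq
    by_cases hK : M.jointWith π p Set.univ = 0
    · have hzero : ∀ τ : CIRLPolicyPair S AH AR Θ, M.jointWith τ p = 0 →
          ∑' h : (take p.time ⁻¹' {p} : Set (CIRLHistory S AH AR)),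
            M.γ ^ h.1.time * M.histReward τ h = 0 := by
        intro τ hτ
        rw [← (takeFiberEquiv p).symm.tsum_eq]
        refine (tsum_congr fun h => ?_).trans tsum_zero
        rw [show ((takeFiberEquiv p).symm h : CIRLHistory S AH AR) = p.append h.1 from rfl,
          M.histReward_append τ h.2, hτ, integral_zero_measure, mul_zero]
      rw [Measure.measure_univ_eq_zero] at hK
      rw [hzero π hK, hzero π' (hj.trans hK)]
    · have hK' := M.jointWith_univ_ne_top π p
      have hprob := M.isProbabilityMeasure_belief π hK
      have hb := M.jointWith_eq_smul_belief π hK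
      have hsub := hM.subgame hK hK' hb
      rw [hM.tsum_fiber_eq hK hK' hb, hM.tsum_fiber_eq hK hK' (hj.trans hb)]
      refine mul_le_mul_of_nonneg_left ?_
        (mul_nonneg (M.gamma_pow_nonneg _) ENNReal.toReal_nonneg)
      refine (hρ p rfl hprob hsub (π.shift p)).trans_eq ?_
      rw [hsub.value_eq, hsub.value_eq]
      refine tsum_congr fun h => ?_
      by_cases hi : h.init = p.current
      · rw [histReward_congr (π := ρ p) (π' := π'.shift p) fun q hq =>
          have e := shift_switch_agree π ρ ((init_of_mem_prefixes hq).trans hi)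
          ⟨e.1.symm, e.2.symm⟩]
      · rw [M.histReward_subgame_eq_zero _ hi, M.histReward_subgame_eq_zero _ hi]
  -- A history whose part up to `N` does not have time `N` ends before `N`, where both pairs make
  -- the same decisions.
  · refine le_of_eq (tsum_congr fun h => ?_)
    have hlt : h.1.time < N := by
      by_contra hn
      refine hp ?_
      rw [← show h.1.take N = p from h.2, time_take]
      omega
    rw [histReward_congr fun q hq =>
      have e := switch_agree π ρ ((time_le_of_mem_prefixes hq).trans_lt hlt)
      ⟨e.1.symm, e.2.symm⟩]

end Switch

/-! ### The stationary policy pair -/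

section Stationary

-- Bayes' rule without normalization. The new joint law depends only on the old one and on the
-- decisions at `h`, so policies that consult their own beliefs can be defined by recursion on the
-- history, without circularity.
open Classical in
lemma jointWith_step [MeasurableSingletonClass S] (h : CIRLHistory S AH AR) (aH : AH) (aR : AR)
    (s : S) :
    M.jointWith π (step h aH aR s) = if π.robot h = aR then
      M.T h.current aH aR s • (M.jointWith π h).restrict {θ | π.human h θ = aH} else 0 := by
  ext B hB
  have hBa : MeasurableSet (B ∩ {θ | π.human h θ = aH}) := hB.inter (π.measurableSet_human h aH)
  have happ : ∀ (h : CIRLHistory S AH AR) {B : Set Θ}, MeasurableSet B → M.jointWith π h B =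
      ∫⁻ x, M.likelihood π x h * B.indicator 1 x.2 ∂M.P₀ := fun h B hB => by
    rw [← lintegral_indicator_one hB, M.lintegral_jointWith π h (measurable_one.indicator hB)]
  rw [happ _ hB]
  split_ifs with hR
  · rw [Measure.smul_apply, Measure.restrict_apply hB, happ _ hBa, smul_eq_mul,
      ← lintegral_const_mul' _ _ (PMF.apply_ne_top _ _)]
    refine lintegral_congr fun x => ?_
    rw [likelihood_step]
    by_cases hx : π.human h x.2 = aH <;> by_cases hxB : x.2 ∈ B <;>
      simp [hx, hxB, hR, mul_comm]
  · simp [likelihood_step, hR]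

variable (M) (σ : S → Measure Θ → CIRLPolicyPair S AH AR Θ)

open Classical in
/-- The joint subdistribution of history and reward parameter when both players always make the
first move of `σ s b`, where `s` is the current state and `b` the belief of the robot. -/
noncomputable def stationaryJoint : CIRLHistory S AH AR → Measure Θ
  -- No decision precedes time 0, so the policy pair used here is irrelevant.
  | start s => M.jointWith (σ s 0) (start s)
  | step h aH aR s =>
      if (σ h.current ((stationaryJoint h Set.univ)⁻¹ • stationaryJoint h)).robot
        (start h.current) = aR then
        M.T h.current aH aR s • (stationaryJoint h).restrict {θ |
          (σ h.current ((stationaryJoint h Set.univ)⁻¹ • stationaryJoint h)).human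
            (start h.current) θ = aH}
      else 0

/-- Both players always make the first move of `σ s b`, where `s` is the current state and `b`
the belief of the robot. -/
noncomputable def stationaryPolicy : CIRLPolicyPair S AH AR Θ where
  human h := (σ h.current ((M.stationaryJoint σ h Set.univ)⁻¹ • M.stationaryJoint σ h)).human
    (start h.current)
  robot h := (σ h.current ((M.stationaryJoint σ h Set.univ)⁻¹ • M.stationaryJoint σ h)).robot
    (start h.current)
  measurableSet_human _ _ := (σ _ _).measurableSet_human _ _

variable [MeasurableSingletonClass S]

lemma jointWith_stationaryPolicy (h : CIRLHistory S AH AR) :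
    M.jointWith (M.stationaryPolicy σ) h = M.stationaryJoint σ h := by
  induction h with
  | start s => exact jointWith_congr fun p hp => absurd hp (Nat.not_lt_zero _)
  | step h aH aR s ih => rw [jointWith_step, ih]; rfl

lemma stationaryPolicy_human (h : CIRLHistory S AH AR) :
    (M.stationaryPolicy σ).human h =
      (σ h.current (M.belief (M.stationaryPolicy σ) h)).human (start h.current) := by
  rw [belief, jointWith_stationaryPolicy]; rfl

lemma stationaryPolicy_robot (h : CIRLHistory S AH AR) :
    (M.stationaryPolicy σ).robot h =
      (σ h.current (M.belief (M.stationaryPolicy σ) h)).robot (start h.current) := by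
  rw [belief, jointWith_stationaryPolicy]; rfl

variable {M σ} [Countable S] [Finite AH] [Finite AR] [Nonempty AH] [Nonempty AR]

/-- For each `N`, there is an optimal policy pair that coincides with the stationary one before
time `N`. -/
lemma UniformlyConvergent.exists_isOptimal_agree (hM : M.UniformlyConvergent)
    (hσ : ∀ s b, ∀ _ : IsProbabilityMeasure b, (M.subgame s b).UniformlyConvergent →
      (M.subgame s b).IsOptimal (σ s b)) (N : ℕ) :
    ∃ π, M.IsOptimal π ∧ ∀ h : CIRLHistory S AH AR, h.time < N →
      π.human h = (M.stationaryPolicy σ).human h ∧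
        π.robot h = (M.stationaryPolicy σ).robot h := by
  induction N with
  | zero =>
    obtain ⟨π, hπ⟩ := hM.exists_isOptimal
    exact ⟨π, hπ, fun h hh => absurd hh (Nat.not_lt_zero _)⟩
  | succ N ih =>
    obtain ⟨π, hπ, hag⟩ := ih
    refine ⟨switch N π fun p => σ p.current (M.belief π p), fun π' => (hπ π').trans
      (hM.value_le_value_switch N fun p _ hprob hsub => hσ _ _ hprob hsub), fun h hh => ?_⟩
    rcases Nat.lt_succ_iff_lt_or_eq.1 hh with hlt | rfl
    · have e := switch_agree π (fun p => σ p.current (M.belief π p)) hlt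
      exact ⟨e.1.trans (hag h hlt).1, e.2.trans (hag h hlt).2⟩
    -- `π` agrees with the stationary pair before the time of `h`, so both induce the same belief at
    -- `h`, and the switched pair makes the first move of the same `σ`.
    · have hb : M.belief π h = M.belief (M.stationaryPolicy σ) h := by
        rw [belief, belief, jointWith_congr hag]
      rw [stationaryPolicy_human, stationaryPolicy_robot, ← hb]
      simp [switch, take_eq_self le_rfl, drop_eq_start le_rfl]

end Stationary

end CIRLGame

/-- A CIRL game has an optimal policy pair that depends on the history only through the current
world state and the belief of the robot. -/
theorem corollary1 {S AH AR Θ : Type*}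
    [MeasurableSpace S] [MeasurableSingletonClass S] [Countable S]
    [Finite AH] [Nonempty AH] [Finite AR] [Nonempty AR] [MeasurableSpace Θ]
    (M : CIRLGame S AH AR Θ) (hM : M.UniformlyConvergent) :
    ∃ π : CIRLPolicyPair S AH AR Θ, M.IsOptimal π ∧ M.DependsOnlyOnStateAndBelief π := by
  -- `σ` must be defined for every measure `b`; where the continuation game is not well defined, an
  -- arbitrary pair is used.
  have hex : ∀ s b, ∃ π : CIRLPolicyPair S AH AR Θ, ∀ _ : IsProbabilityMeasure b,
      (M.subgame s b).UniformlyConvergent → (M.subgame s b).IsOptimal π := by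
    intro s b
    by_cases hb : ∃ _ : IsProbabilityMeasure b, (M.subgame s b).UniformlyConvergent
    · obtain ⟨_, hsub⟩ := hb
      obtain ⟨π, hπ⟩ := hsub.exists_isOptimal
      exact ⟨π, fun _ _ => hπ⟩
    · obtain ⟨π, -⟩ := hM.exists_isOptimal
      exact ⟨π, fun hprob hsub => absurd ⟨hprob, hsub⟩ hb⟩
  choose σ hσ using hex
  refine ⟨M.stationaryPolicy σ, fun π' => le_of_forall_pos_le_add fun ε hε => ?_,
    fun s b => (σ s b).human (.start s), fun s b => (σ s b).robot (.start s), fun h =>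
    ⟨fun θ => by rw [M.stationaryPolicy_human], M.stationaryPolicy_robot σ h⟩⟩
  obtain ⟨A, hA⟩ := hM.exists_finset_abs_value_sub_le hε
  -- Agreement holds strictly before the given time, so `+ 1` covers every history in `A`.
  obtain ⟨π, hπ, hag⟩ := hM.exists_isOptimal_agree hσ (A.sup CIRLHistory.time + 1)
  have h1 := (abs_le.1 (hA π (M.stationaryPolicy σ) fun h hh =>
    hag h (Nat.lt_succ_of_le (Finset.le_sup hh)))).2
  have h2 := hπ π'
  linarith
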